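/- Let $G$ be a group and let $\psi$ be an automorphism of $G$. Elements $x,y\in G$ are called $\psi$-conjugate if $x=zy\psi(z)^{-1}$ for some $z\in G$. This is an equivalence relation, and the Reidemeister number $R(\psi)$ is the number of its classes (a positive integer or $\infty$). For a field $F$ and an even integer $n\ge 2$ let $$\Omega=\underbrace{J\oplus\dots\oplus J}_{n/2},\qquad J=\begin{pmatrix}0&1\\-1&0\end{pmatrix},\qquad \mathrm{Sp}_n(F)=\{A\in \mathrm{GL}_n(F)\mid A\Omega A^T=\Omega\}.$$ Every automorphism $\varphi$ of $F$ induces an automorphism $\varphi_n$ of the group $\mathrm{Sp}_n(F)$ by $\varphi_n((a_{i,j}))=(\varphi(a_{i,j}))$. **Theorem.** Let $F$ be an algebraically closed field of characteristic zero with infinite transcendence degree over $\mathbb{Q}$, and let $n\ge 2$ be an even integer. Then there exists an automorphism $\varphi$ of the field $F$ such that the induced automorphism $\varphi_n$ of $\mathrm{Sp}_n(F)$ satisfies $R(\varphi_n)=1$. -/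

import Mathlib

open scoped Matrix

/-- Two elements `x`, `y` of a group are twisted conjugate with respect to an automorphism `φ`
if `x = z * y * φ(z)⁻¹` for some `z` in the group. -/
def IsTwistedConj {G : Type*} [Group G] (φ : G ≃* G) (x y : G) : Prop :=
  ∃ z : G, x = z * y * (φ z)⁻¹

/-- Twisted conjugacy is an equivalence relation. -/
def twistedConjSetoid {G : Type*} [Group G] (φ : G ≃* G) : Setoid G where
  r := IsTwistedConj φ
  iseqv :=
    { refl := fun x => ⟨1, by simp⟩
      symm := by
        rintro x y ⟨z, rfl⟩
        exact ⟨z⁻¹, by simp [mul_assoc]⟩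
      trans := by
        rintro x y w ⟨z, rfl⟩ ⟨t, rfl⟩
        exact ⟨z * t, by simp [mul_assoc]⟩ }

/-- The Reidemeister number of `φ`: the number of twisted conjugacy classes, with all infinite
cardinalities identified with `⊤`. -/
noncomputable def reidemeisterNumber {G : Type*} [Group G] (φ : G ≃* G) : ℕ∞ :=
  ENat.card (Quotient (twistedConjSetoid φ))

/-- The `2m × 2m` matrix `Ω = J ⊕ ⋯ ⊕ J` (`m` summands) with `J = (0 1; -1 0)`. The index `(a, k)`
stands for the `a`-th position in the `k`-th block. -/
def symplecticForm (m : ℕ) (F : Type*) [Field F] : Matrix (Fin 2 × Fin m) (Fin 2 × Fin m) F :=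
  Matrix.blockDiagonal fun _ : Fin m => !![0, 1; -1, 0]

/-- The symplectic group `Sp_{2m}(F) = {A ∈ GL_{2m}(F) | A Ω Aᵀ = Ω}`. -/
def Sp (m : ℕ) (F : Type*) [Field F] : Subgroup (GL (Fin 2 × Fin m) F) where
  carrier := {A | (A : Matrix (Fin 2 × Fin m) (Fin 2 × Fin m) F) * symplecticForm m F *
    (A : Matrix (Fin 2 × Fin m) (Fin 2 × Fin m) F)ᵀ = symplecticForm m F}
  one_mem' := by simp
  mul_mem' := by
    intro A B hA hB
    simp only [Set.mem_ofPred_eq, Units.val_mul, Matrix.transpose_mul] at hA hB ⊢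
    calc _ = A.1 * (B.1 * symplecticForm m F * B.1ᵀ) * A.1ᵀ := by simp only [Matrix.mul_assoc]
      _ = _ := by rw [hB, hA]
  inv_mem' := by
    intro A hA
    simp only [Set.mem_ofPred_eq] at hA ⊢
    have h1 : (A⁻¹).1 * A.1 = 1 := A.inv_mul
    have h2 : A.1ᵀ * (A⁻¹).1ᵀ = 1 := by
      rw [← Matrix.transpose_mul, h1, Matrix.transpose_one]
    calc (A⁻¹).1 * symplecticForm m F * (A⁻¹).1ᵀ
        = (A⁻¹).1 * (A.1 * symplecticForm m F * A.1ᵀ) * (A⁻¹).1ᵀ := by rw [hA]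
      _ = ((A⁻¹).1 * A.1) * symplecticForm m F * (A.1ᵀ * (A⁻¹).1ᵀ) := by
        simp only [Matrix.mul_assoc]
      _ = symplecticForm m F := by rw [h1, h2, Matrix.one_mul, Matrix.mul_one]

theorem Sp.map_mem {m : ℕ} {F : Type*} [Field F] (φ : F ≃+* F) {A : GL (Fin 2 × Fin m) F}
    (hA : A ∈ Sp m F) : Matrix.GeneralLinearGroup.map φ.toRingHom A ∈ Sp m F := by
  have hA' : A.1 * symplecticForm m F * A.1ᵀ = symplecticForm m F := hA
  have hΩ : (symplecticForm m F).map φ.toRingHom = symplecticForm m F := by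
    ext ⟨a, k⟩ ⟨b, l⟩
    fin_cases a <;> fin_cases b <;>
      by_cases h : k = l <;> simp [symplecticForm, Matrix.blockDiagonal_apply, h]
  have h := congrArg (fun M => M.map φ.toRingHom) hA'
  simp only [Matrix.map_mul, Matrix.transpose_map, hΩ] at h
  exact h

/-- The automorphism of `Sp_{2m}(F)` induced by a field automorphism `φ`: it applies `φ` to every
entry of a matrix. -/
noncomputable def Sp.inducedAut (m : ℕ) {F : Type*} [Field F] (φ : F ≃+* F) :
    Sp m F ≃* Sp m F where
  toFun A := ⟨Matrix.GeneralLinearGroup.map φ.toRingHom A.1, Sp.map_mem φ A.2⟩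
  invFun A := ⟨Matrix.GeneralLinearGroup.map φ.symm.toRingHom A.1, Sp.map_mem φ.symm A.2⟩
  left_inv A := by
    ext i j
    simp
  right_inv A := by
    ext i j
    simp
  map_mul' A B := by
    ext i j
    simp


/-!
It suffices to find `φ` such that every `A ∈ Sp m F` can be written `Z * φ(Z)⁻¹` with `Z ∈ Sp m F`.

Given an automorphism `σ` of `F`, adjoin to `F` an invertible generic matrix `X_A` for every
`A ∈ GL n F` and extend `σ` by `X_A ↦ A⁻¹ * X_A`, so that `X_A` solves `A * σ(X_A) = X_A`. The
algebraic closure of this extension has the cardinality of `F`, hence, the transcendence degree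
being infinite, it is isomorphic to `F` by Steinitz. After countably many such steps all equations
with coefficients in the direct limit have been solved, and the limit is again isomorphic to `F`.

If `A` is symplectic and `A * φ(Z) = Z` with `Z` merely invertible, then the alternating form
`Z⁻¹ * Ω * Z⁻ᵀ` is fixed by `φ`. Over the fixed field of `φ` it is therefore congruent to `Ω` by
some matrix `C`, and `Z * C⁻¹` is a symplectic solution.
-/

theorem reidemeisterNumber_eq_one {G : Type*} [Group G] {ψ : G ≃* G}
    (h : ∀ x, IsTwistedConj ψ x 1) : reidemeisterNumber ψ = 1 := by
  have class_eq (x : G) : Quotient.mk (twistedConjSetoid ψ) x = Quotient.mk _ 1 :=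
    Quotient.sound (h x)
  rw [reidemeisterNumber, ENat.card_eq_one_iff_unique, unique_iff_existsUnique]
  exact ⟨Quotient.mk _ 1, trivial, fun q _ => q.inductionOn class_eq⟩

section LangSolvable

open Matrix

variable {n K L M : Type*} [Fintype n] [DecidableEq n] [CommRing K] [CommRing L] [CommRing M]

/-- Lang's property for `GL n`, relative to a ring map `f : K →+* L`: every invertible matrix over
`K` becomes of the form `Z * τ(Z)⁻¹` over `L`. For `f = RingHom.id L` this is surjectivity of the
Lang map `Z ↦ Z * τ(Z)⁻¹` on `GL n L`. -/
def LangSolvable (n : Type*) [Fintype n] [DecidableEq n] (f : K →+* L) (τ : L →+* L) : Prop :=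
  ∀ A : GL n K, ∃ Z : GL n L, GeneralLinearGroup.map f A * GeneralLinearGroup.map τ Z = Z

theorem LangSolvable.comp_left {f : K →+* L} {τ : L →+* L} (h : LangSolvable n f τ) {g : L →+* M}
    {ρ : M →+* M} (hg : ρ.comp g = g.comp τ) : LangSolvable n (g.comp f) ρ := by
  intro A
  obtain ⟨Z, hZ⟩ := h A
  refine ⟨GeneralLinearGroup.map g Z, ?_⟩
  calc GeneralLinearGroup.map (g.comp f) A * GeneralLinearGroup.map (ρ.comp g) Z
      = GeneralLinearGroup.map g (GeneralLinearGroup.map f A * GeneralLinearGroup.map τ Z) := by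
        rw [hg, map_mul]; rfl
    _ = GeneralLinearGroup.map g Z := by rw [hZ]

theorem LangSolvable.comp_right {f : L →+* M} {τ : M →+* M} (h : LangSolvable n f τ)
    (g : K →+* L) : LangSolvable n (f.comp g) τ :=
  fun A => h (GeneralLinearGroup.map g A)

end LangSolvable

section GenericMatrix

open Matrix MvPolynomial

variable {S n R : Type*} [CommRing R]

/-- The `n × n` matrix of independent indeterminates carrying the label `s`. -/
noncomputable def genericMatrix (n R : Type*) [CommRing R] (s : S) :
    Matrix n n (MvPolynomial (S × n × n) R) :=
  (mvPolynomialX n n R).map (rename (Prod.mk s))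

theorem genericMatrix_apply (s : S) (i j : n) : genericMatrix n R s i j = X (s, i, j) := by
  simp only [genericMatrix, map_apply, mvPolynomialX_apply, rename_X]

variable [Fintype n]

theorem det_genericMatrix_ne_zero [DecidableEq n] [Nontrivial R] (s : S) :
    (genericMatrix n R s).det ≠ 0 := by
  have rename_inj : Function.Injective (rename (R := R) (Prod.mk (β := n × n) s)) :=
    rename_injective _ (Prod.mk_right_injective s)
  rw [genericMatrix, ← AlgHom.mapMatrix_apply, ← AlgHom.map_det, ne_eq,
    map_eq_zero_iff _ rename_inj]
  exact det_mvPolynomialX_ne_zero n R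

/-- The `R`-algebra endomorphism multiplying each generic matrix `genericMatrix n R s` by `u s` on
the left. -/
noncomputable def genericTranslate (u : S → Matrix n n R) :
    MvPolynomial (S × n × n) R →ₐ[R] MvPolynomial (S × n × n) R :=
  aeval fun (s, i, j) =>
    ((u s).map C * genericMatrix n R s : Matrix n n (MvPolynomial (S × n × n) R)) i j

theorem map_genericTranslate (u : S → Matrix n n R) (s : S) :
    (genericMatrix n R s).map (genericTranslate u) = (u s).map C * genericMatrix n R s := by
  ext1 i j
  simp only [map_apply, genericMatrix_apply, genericTranslate, aeval_X]

theorem genericTranslate_comp_of_mul_eq_one [DecidableEq n] {u v : S → Matrix n n R}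
    (h : ∀ s, v s * u s = 1) :
    (genericTranslate u).comp (genericTranslate v) = AlgHom.id R _ := by
  have map_comp (s : S) :
      ((genericMatrix n R s).map (genericTranslate v)).map (genericTranslate u) =
        genericMatrix n R s := by
    have map_C : ((v s).map C).map (genericTranslate u) = (v s).map (C (σ := S × n × n)) :=
      Matrix.ext fun i j => (genericTranslate u).commutes (v s i j)
    rw [map_genericTranslate, Matrix.map_mul, map_C, map_genericTranslate, ← Matrix.mul_assoc,
      ← Matrix.map_mul, h, Matrix.map_one _ (map_zero _) (map_one _), Matrix.one_mul]
  ext1 ⟨s, i, j⟩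
  simpa only [map_apply, genericMatrix_apply, AlgHom.comp_apply, AlgHom.id_apply] using
    congrFun₂ (map_comp s) i j

theorem exists_ringEquiv_mul_map_genericMatrix [DecidableEq n] (σ : R ≃+* R) (u : S → GL n R) :
    ∃ Φ : MvPolynomial (S × n × n) R ≃+* MvPolynomial (S × n × n) R,
      (∀ x, Φ (C x) = C (σ x)) ∧
      ∀ s, (u s).1.map C * (genericMatrix n R s).map Φ = genericMatrix n R s := by
  let translate : MvPolynomial (S × n × n) R ≃ₐ[R] MvPolynomial (S × n × n) R :=
    AlgEquiv.ofAlgHom (genericTranslate fun s => (u s)⁻¹.1) (genericTranslate fun s => (u s).1)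
      (genericTranslate_comp_of_mul_eq_one fun s => (u s).mul_inv)
      (genericTranslate_comp_of_mul_eq_one fun s => (u s).inv_mul)
  refine ⟨(mapEquiv _ σ).trans translate.toRingEquiv, fun x => ?_, fun s => ?_⟩
  · change translate (map (σ : R →+* R) (C x)) = _
    rw [map_C]
    exact translate.commutes (σ x)
  · have map_generic : (genericMatrix n R s).map ((mapEquiv _ σ).trans translate.toRingEquiv) =
        (genericMatrix n R s).map (genericTranslate fun s => (u s)⁻¹.1) := by
      ext1 i j
      simp [genericMatrix_apply, translate]
    rw [map_generic, map_genericTranslate, ← Matrix.mul_assoc, ← Matrix.map_mul, (u s).mul_inv,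
      Matrix.map_one _ (map_zero _) (map_one _), Matrix.one_mul]

end GenericMatrix

section Extension

open Cardinal Matrix

theorem exists_isAlgClosed_ringEquiv_extends.{u} {R : Type u} [CommRing R] [IsDomain R]
    (Φ : R ≃+* R) :
    ∃ (L : Type u) (_ : Field L) (_ : IsAlgClosed L) (ι : R →+* L) (τ : L ≃+* L),
      Function.Injective ι ∧ (∀ x, τ (ι x) = ι (Φ x)) ∧ #L ≤ max #R ℵ₀ := by
  let Q := FractionRing R
  let L := AlgebraicClosure Q
  let τ : L ≃+* L :=
    IsAlgClosure.equivOfEquiv L L (IsFractionRing.ringEquivOfRingEquiv (K := Q) (L := Q) Φ)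
  refine ⟨L, inferInstance, inferInstance, (algebraMap Q L).comp (algebraMap R Q), τ,
    (algebraMap Q L).injective.comp (IsFractionRing.injective R Q), fun x => ?_, ?_⟩
  · simp only [τ, RingHom.comp_apply, IsAlgClosure.equivOfEquiv_algebraMap,
      IsFractionRing.ringEquivOfRingEquiv_algebraMap]
  · rw [← mk_fractionRing R]
    exact Algebra.IsAlgebraic.cardinalMk_le_max Q L

theorem mk_GL_le (n : Type) [Fintype n] [DecidableEq n] (R : Type*) [CommRing R] :
    #(GL n R) ≤ max #R ℵ₀ := calc
  #(GL n R) ≤ #(Matrix n n R) := mk_le_of_injective Units.val_injective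
  _ = #(n × n → R) := mk_congr (Equiv.curry n n R).symm
  _ = #R ^ (Fintype.card (n × n) : Cardinal) := by
    rw [mk_arrow, mk_fintype (n × n), lift_natCast, lift_uzero]
  _ ≤ max #R ℵ₀ := power_nat_le_max

theorem mk_mvPolynomial_GL_le (n : Type) [Fintype n] [DecidableEq n] (R : Type*) [CommRing R] :
    #(MvPolynomial (GL n R × n × n) R) ≤ max #R ℵ₀ := by
  have vars_le : #(GL n R × n × n) ≤ max #R ℵ₀ := calc
    #(GL n R × n × n) = #(GL n R) * lift #(n × n) := by rw [mk_prod, lift_uzero]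
    _ ≤ max #R ℵ₀ * ℵ₀ := mul_le_mul' (mk_GL_le n R) (lift_le_aleph0.2 mk_le_aleph0)
    _ = max #R ℵ₀ := mul_aleph0_eq (le_max_right _ _)
  exact MvPolynomial.cardinalMk_le_max.trans
    (max_le (max_le (le_max_left _ _) vars_le) (le_max_right _ _))

theorem exists_isAlgClosed_langSolvable.{u} (n : Type) [Fintype n] [DecidableEq n] {K : Type u}
    [Field K] (σ : K ≃+* K) :
    ∃ (L : Type u) (_ : Field L) (_ : IsAlgClosed L) (f : K →+* L) (τ : L ≃+* L),
      (∀ x, τ (f x) = f (σ x)) ∧ LangSolvable n f (τ : L →+* L) ∧ #L ≤ max #K ℵ₀ := by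
  obtain ⟨Φ, hΦC, hΦ⟩ := exists_ringEquiv_mul_map_genericMatrix σ (fun A : GL n K => A)
  obtain ⟨L, _, _, ι, τ, ι_inj, hτ, mk_le⟩ := exists_isAlgClosed_ringEquiv_extends Φ
  refine ⟨L, inferInstance, inferInstance, ι.comp MvPolynomial.C, τ, fun x => ?_, fun A => ?_,
    mk_le.trans (max_le (mk_mvPolynomial_GL_le n K) (le_max_right _ _))⟩
  · simp only [RingHom.comp_apply, hτ, hΦC]
  · let X := genericMatrix n K A
    have det_ne_zero : (ι.mapMatrix X).det ≠ 0 := by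
      rw [← RingHom.map_det, ne_eq, map_eq_zero_iff ι ι_inj]
      exact det_genericMatrix_ne_zero A
    have map_comm : (X.map ι).map τ = (X.map Φ).map ι := Matrix.ext fun i j => hτ (X i j)
    refine ⟨GeneralLinearGroup.mkOfDetNeZero _ det_ne_zero, Units.ext ?_⟩
    calc (A.1.map MvPolynomial.C).map ι * (X.map ι).map τ
        = (A.1.map MvPolynomial.C * X.map Φ).map ι := by rw [map_comm, Matrix.map_mul]
      _ = X.map ι := by rw [hΦ]

end Extension

section Steinitz

open Cardinal

variable {k : Type*} [Field k] [Countable k]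

theorem mk_eq_trdeg_of_aleph0_le {F : Type*} [Field F] [IsAlgClosed F] [Algebra k F]
    (hF : ℵ₀ ≤ Algebra.trdeg k F) : #F = Algebra.trdeg k F := by
  obtain ⟨s, hs⟩ := exists_isTranscendenceBasis k F
  refine le_antisymm ?_ (hs.cardinalMk_eq_trdeg ▸ mk_set_le s)
  have mk_le := IsAlgClosed.cardinal_le_max_transcendence_basis _ hs
  rw [hs.cardinalMk_eq_trdeg] at mk_le
  have aleph0_le := aleph0_le_lift.2 hF
  exact lift_le.1 <| mk_le.trans <|
    max_le (max_le ((lift_le_aleph0.2 mk_le_aleph0).trans aleph0_le) le_rfl) aleph0_le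

theorem nonempty_ringEquiv_of_ringHom.{u} {F L : Type u} [Field F] [Field L] [IsAlgClosed F]
    [IsAlgClosed L] [Algebra k F] (hF : ℵ₀ ≤ Algebra.trdeg k F) (f : F →+* L) (hL : #L ≤ #F) :
    Nonempty (F ≃+* L) := by
  let := (f.comp (algebraMap k F)).toAlgebra
  have trdeg_le : Algebra.trdeg k F ≤ Algebra.trdeg k L :=
    trdeg_le_of_injective (⟨f, fun _ => rfl⟩ : F →ₐ[k] L) f.injective
  have trdeg_eq : Algebra.trdeg k F = Algebra.trdeg k L :=
    trdeg_le.antisymm <| by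
      rwa [← mk_eq_trdeg_of_aleph0_le hF, ← mk_eq_trdeg_of_aleph0_le (hF.trans trdeg_le)]
  obtain ⟨s, hs⟩ := exists_isTranscendenceBasis k F
  obtain ⟨t, ht⟩ := exists_isTranscendenceBasis k L
  rw [← hs.cardinalMk_eq_trdeg, ← ht.cardinalMk_eq_trdeg] at trdeg_eq
  obtain ⟨b⟩ := Cardinal.eq.mp trdeg_eq
  exact ⟨IsAlgClosed.equivOfTranscendenceBasis _ _ b hs ht⟩

theorem exists_ringHom_self_langSolvable (n : Type) [Fintype n] [DecidableEq n] {F : Type*}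
    [Field F] [IsAlgClosed F] [Algebra k F] (hF : ℵ₀ ≤ Algebra.trdeg k F) (σ : F ≃+* F) :
    ∃ (f : F →+* F) (τ : F ≃+* F),
      (∀ x, τ (f x) = f (σ x)) ∧ LangSolvable n f (τ : F →+* F) := by
  obtain ⟨L, _, _, f, τ, hτ, lang, mk_le⟩ := exists_isAlgClosed_langSolvable n σ
  obtain ⟨e⟩ := nonempty_ringEquiv_of_ringHom hF f (mk_le.trans (max_le le_rfl (aleph0_le_mk F)))
  refine ⟨(e.symm : L →+* F).comp f, (e.trans τ).trans e.symm, fun x => ?_, lang.comp_left ?_⟩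
  · simp [hτ]
  · ext x
    simp

end Steinitz

section DirectLimit

open DirectLimit.Ring

variable {ι : Type*} [Preorder ι] [IsDirectedOrder ι] [Nonempty ι] {G : ι → Type*}
  [∀ i, NonAssocSemiring (G i)] {f : ∀ i j, i ≤ j → G i →+* G j} [DirectedSystem G (f · · ·)]

theorem exists_subset_range_of (s : Finset (DirectLimit G f)) :
    ∃ i, (s : Set (DirectLimit G f)) ⊆ Set.range (of G f i) := by
  refine Directed.exists_mem_subset_of_finset_subset_biUnion (directed_of_isDirected_le ?_) ?_
  · rintro i j hij _ ⟨x, rfl⟩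
    exact ⟨f i j hij x, of_f hij x⟩
  · intro z _
    obtain ⟨i, x, rfl⟩ := DirectLimit.exists_eq_mk f z
    exact Set.mem_iUnion.2 ⟨i, x, rfl⟩

/-- The automorphism of a direct limit induced by automorphisms of its components. -/
noncomputable def directLimitRingEquiv (σ : ∀ i, G i ≃+* G i)
    (hσ : ∀ i j hij x, σ j (f i j hij x) = f i j hij (σ i x)) :
    DirectLimit G f ≃+* DirectLimit G f :=
  have hσ_symm (i j : ι) (hij : i ≤ j) (x : G i) :
      (σ j).symm (f i j hij x) = f i j hij ((σ i).symm x) := by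
    rw [RingEquiv.symm_apply_eq, hσ, RingEquiv.apply_symm_apply]
  RingEquiv.ofRingHom
    (DirectLimit.Ring.lift G f _ (fun i => (of G f i).comp (σ i)) fun i j hij x =>
      (congrArg (of G f j) (hσ i j hij x)).trans (of_f hij _))
    (DirectLimit.Ring.lift G f _ (fun i => (of G f i).comp (σ i).symm) fun i j hij x =>
      (congrArg (of G f j) (hσ_symm i j hij x)).trans (of_f hij _))
    (hom_ext _ fun i => RingHom.ext fun x => congrArg (of G f i) ((σ i).apply_symm_apply x))
    (hom_ext _ fun i => RingHom.ext fun x => congrArg (of G f i) ((σ i).symm_apply_apply x))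

theorem directLimitRingEquiv_of {σ : ∀ i, G i ≃+* G i}
    (hσ : ∀ i j hij x, σ j (f i j hij x) = f i j hij (σ i x)) (i : ι) (x : G i) :
    directLimitRingEquiv σ hσ (of G f i x) = of G f i (σ i x) :=
  rfl

end DirectLimit

section FieldDirectLimit

open Matrix DirectLimit.Ring

variable {ι : Type*} [Preorder ι] [IsDirectedOrder ι] [Nonempty ι] {G : ι → Type*}
  [∀ i, Field (G i)] {f : ∀ i j, i ≤ j → G i →+* G j} [DirectedSystem G (f · · ·)]

theorem isAlgClosed_directLimit [∀ i, IsAlgClosed (G i)] : IsAlgClosed (DirectLimit G f) := by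
  refine .of_exists_root _ fun p _ hp => ?_
  obtain ⟨i, hi⟩ := exists_subset_range_of p.coeffs
  obtain ⟨q, rfl⟩ := (Polynomial.mem_lifts p).1 ((Polynomial.lifts_iff_coeffs_subset_range p).2 hi)
  obtain ⟨x, hx⟩ := IsAlgClosed.exists_root q <| by
    rw [← Polynomial.degree_map q (of G f i)]
    exact (Polynomial.degree_pos_of_irreducible hp).ne'
  exact ⟨of G f i x, hx.map⟩

theorem exists_map_of_eq {n : Type*} [Fintype n] [DecidableEq n] (A : GL n (DirectLimit G f)) :
    ∃ i A₀, GeneralLinearGroup.map (of G f i) A₀ = A := by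
  classical
  obtain ⟨i, hi⟩ := exists_subset_range_of (Finset.univ.image fun p : n × n => A p.1 p.2)
  have entry_mem (p q : n) : A p q ∈ Set.range (of G f i) :=
    hi (Finset.mem_image_of_mem _ (Finset.mem_univ (p, q)))
  obtain ⟨A₀, hA₀⟩ : ∃ A₀ : Matrix n n (G i), (of G f i).mapMatrix A₀ = A :=
    ⟨Matrix.of fun p q => (entry_mem p q).choose, Matrix.ext fun p q => (entry_mem p q).choose_spec⟩
  have det_ne_zero : A₀.det ≠ 0 := by
    rw [← map_ne_zero (of G f i), RingHom.map_det, hA₀]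
    exact A.det_ne_zero
  exact ⟨i, GeneralLinearGroup.mkOfDetNeZero A₀ det_ne_zero, Units.ext hA₀⟩

theorem langSolvable_directLimitRingEquiv {n : Type*} [Fintype n] [DecidableEq n]
    {σ : ∀ i, G i ≃+* G i} (hσ : ∀ i j hij x, σ j (f i j hij x) = f i j hij (σ i x))
    (h : ∀ i, ∃ j hij, LangSolvable n (f i j hij) (σ j : G j →+* G j)) :
    LangSolvable n (RingHom.id (DirectLimit G f))
      (directLimitRingEquiv σ hσ : DirectLimit G f →+* DirectLimit G f) := by
  intro A
  obtain ⟨i, A₀, rfl⟩ := exists_map_of_eq A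
  obtain ⟨j, hij, hj⟩ := h i
  have comm : (directLimitRingEquiv σ hσ : DirectLimit G f →+* DirectLimit G f).comp (of G f j) =
      (of G f j).comp (σ j : G j →+* G j) := RingHom.ext (directLimitRingEquiv_of hσ j)
  obtain ⟨Z, hZ⟩ := hj.comp_left comm A₀
  have of_comp : (of G f j).comp (f i j hij) = of G f i := RingHom.ext (of_f hij)
  exact ⟨Z, of_comp ▸ hZ⟩

end FieldDirectLimit

section NatTransition

variable {F : ℕ → Type*} [∀ i, NonAssocSemiring (F i)] (f : ∀ i, F i →+* F (i + 1))

/-- The composite `F i →+* F j` of the ring maps `f i, …, f (j - 1)`. -/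
def natTransition (i j : ℕ) (h : i ≤ j) : F i →+* F j :=
  Nat.leRec (motive := fun j _ => F i →+* F j) (RingHom.id _) (fun k _ g => (f k).comp g) h

theorem natTransition_self (i : ℕ) : natTransition f i i le_rfl = RingHom.id _ :=
  Nat.leRec_self _ _

theorem natTransition_succ {i j : ℕ} (h : i ≤ j) :
    natTransition f i (j + 1) (Nat.le_succ_of_le h) = (f j).comp (natTransition f i j h) :=
  Nat.leRec_succ _ _ _

theorem natTransition_self_succ (i : ℕ) : natTransition f i (i + 1) i.le_succ = f i := by
  rw [natTransition_succ f le_rfl, natTransition_self, RingHom.comp_id]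

instance : DirectedSystem F (natTransition f · · ·) where
  map_self i x := by rw [natTransition_self, RingHom.id_apply]
  map_map k j i hij hjk x := by
    induction k, hjk using Nat.le_induction with
    | base => rw [natTransition_self, RingHom.id_apply]
    | succ k hjk ih =>
      rw [natTransition_succ f hjk, natTransition_succ f (hij.trans hjk), RingHom.comp_apply, ih,
        RingHom.comp_apply]

variable {f} in
theorem natTransition_comm {σ : ∀ i, F i ≃+* F i} (hσ : ∀ i x, σ (i + 1) (f i x) = f i (σ i x))
    (i j : ℕ) (h : i ≤ j) (x : F i) :
    σ j (natTransition f i j h x) = natTransition f i j h (σ i x) := by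
  induction j, h using Nat.le_induction with
  | base => rw [natTransition_self, RingHom.id_apply, RingHom.id_apply]
  | succ j h ih => rw [natTransition_succ f h, RingHom.comp_apply, hσ, ih, RingHom.comp_apply]

end NatTransition

section LangGL

open Cardinal

theorem exists_ringEquiv_langSolvable_id {k : Type*} [Field k] [Countable k] (n : Type) [Fintype n]
    [DecidableEq n] {F : Type*} [Field F] [IsAlgClosed F] [Algebra k F]
    (hF : ℵ₀ ≤ Algebra.trdeg k F) :
    ∃ φ : F ≃+* F, LangSolvable n (RingHom.id F) (φ : F →+* F) := by
  choose embed next next_embed lang using exists_ringHom_self_langSolvable n hF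
  let σ (i : ℕ) : F ≃+* F := next^[i] (RingEquiv.refl F)
  have σ_succ (i : ℕ) : σ (i + 1) = next (σ i) := Function.iterate_succ_apply' ..
  let f (i : ℕ) : F →+* F := embed (σ i)
  have hσ (i : ℕ) (x : F) : σ (i + 1) (f i x) = f i (σ i x) := by rw [σ_succ, next_embed]
  let L := DirectLimit (fun _ : ℕ => F) (natTransition f)
  let τ : L ≃+* L := directLimitRingEquiv σ (natTransition_comm hσ)
  have lang_τ : LangSolvable n (RingHom.id L) (τ : L →+* L) :=
    langSolvable_directLimitRingEquiv _ fun i => ⟨i + 1, i.le_succ, by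
      rw [natTransition_self_succ, σ_succ]
      exact lang (σ i)⟩
  have : IsAlgClosed L := isAlgClosed_directLimit
  have mk_le : #L ≤ #F := calc
    #L ≤ #(Σ _ : ℕ, F) := mk_quotient_le
    _ = ℵ₀ * #F := by simp
    _ = #F := aleph0_mul_eq (aleph0_le_mk F)
  let ι : F →+* L := DirectLimit.Ring.of (fun _ : ℕ => F) (natTransition f) 0
  obtain ⟨e⟩ := nonempty_ringEquiv_of_ringHom hF ι mk_le
  refine ⟨(e.trans τ).trans e.symm, ?_⟩
  have comm : ((e.trans τ).trans e.symm : F →+* F).comp (e.symm : L →+* F) =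
      (e.symm : L →+* F).comp (τ : L →+* L) := by
    ext x
    simp
  have id_eq : (e.symm : L →+* F).comp ((RingHom.id L).comp (e : F →+* L)) = RingHom.id F := by
    ext x
    simp
  exact id_eq ▸ (lang_τ.comp_right (e : F →+* L)).comp_left comm

end LangGL

section SymplecticForm

open Matrix Module

variable {m : ℕ} {k : Type*} [Field k]

theorem symplecticForm_apply (p q : Fin 2 × Fin m) :
    symplecticForm m k p q = if p.2 = q.2 then !![0, 1; -1, 0] p.1 q.1 else 0 :=
  blockDiagonal_apply _ _ _

variable (m k) in
theorem det_symplecticForm : (symplecticForm m k).det = 1 := by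
  simp [symplecticForm, det_blockDiagonal, det_fin_two]

theorem symplecticForm_map {K : Type*} [Field K] (f : k →+* K) :
    (symplecticForm m k).map f = symplecticForm m K := by
  ext1 ⟨a, i⟩ ⟨b, j⟩
  rw [map_apply, symplecticForm_apply, symplecticForm_apply]
  fin_cases a <;> fin_cases b <;> by_cases h : i = j <;> simp [h]

theorem dotProduct_symplecticForm_mulVec_self (v : Fin 2 × Fin m → k) :
    v ⬝ᵥ symplecticForm m k *ᵥ v = 0 := by
  simp [dotProduct, mulVec, Fintype.sum_prod_type, symplecticForm_apply, mul_comm]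

section BilinForm

variable {V : Type*} [AddCommGroup V] [Module k V] {B : LinearMap.BilinForm k V}

theorem exists_apply_eq_one [Nontrivial V] (hB : B.SeparatingLeft) : ∃ v w, B v w = 1 := by
  obtain ⟨v, hv⟩ := exists_ne (0 : V)
  obtain ⟨w, hw⟩ : ∃ w, B v w ≠ 0 := by
    by_contra! h
    exact hv (hB v h)
  exact ⟨v, (B v w)⁻¹ • w, by simp [hw]⟩

theorem mem_orthogonal_span_pair {v w x : V} :
    x ∈ B.orthogonal (Submodule.span k {v, w}) ↔ B v x = 0 ∧ B w x = 0 := by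
  refine ⟨fun h => ⟨h v (Submodule.subset_span (by simp)), h w (Submodule.subset_span (by simp))⟩,
    fun ⟨hv, hw⟩ y hy => ?_⟩
  obtain ⟨a, b, rfl⟩ := Submodule.mem_span_pair.1 hy
  simp [hv, hw]

variable [FiniteDimensional k V]

theorem finrank_le_finrank_orthogonal_span_pair_add_two (hB : B.Nondegenerate) (v w : V) :
    finrank k V ≤ finrank k (B.orthogonal (Submodule.span k {v, w})) + 2 := by
  have span_le : finrank k (Submodule.span k {v, w}) ≤ 2 := by
    rw [← range_cons_cons_empty v w ![]]
    exact finrank_range_le_card ![v, w]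
  rw [LinearMap.BilinForm.finrank_orthogonal hB]
  omega

theorem nondegenerate_restrict_orthogonal_span_pair (halt : B.IsAlt) (hB : B.Nondegenerate)
    {v w : V} (hvw : B v w = 1) :
    (B.restrict (B.orthogonal (Submodule.span k {v, w}))).Nondegenerate := by
  let P := Submodule.span k {v, w}
  have disjoint : Disjoint P (B.orthogonal P) := by
    refine Submodule.disjoint_def.2 fun x hx hx' => ?_
    obtain ⟨a, b, rfl⟩ := Submodule.mem_span_pair.1 hx
    obtain ⟨hv, hw⟩ := mem_orthogonal_span_pair.1 hx'
    have hb : b = 0 := by simpa [halt.self_eq_zero, hvw] using hv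
    have ha : a = 0 := by simpa [halt.self_eq_zero, ← halt.neg_eq v w, hvw] using hw
    simp [ha, hb]
  rw [LinearMap.BilinForm.restrict_nondegenerate_iff_isCompl_orthogonal halt.isRefl,
    LinearMap.BilinForm.orthogonal_orthogonal hB halt.isRefl]
  exact ((LinearMap.BilinForm.isCompl_orthogonal_iff_disjoint halt.isRefl).2 disjoint).symm

end BilinForm

theorem exists_apply_eq_symplecticForm (m : ℕ) : ∀ {V : Type*} [AddCommGroup V] [Module k V]
    [FiniteDimensional k V] {B : LinearMap.BilinForm k V}, B.IsAlt → B.Nondegenerate →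
      2 * m ≤ finrank k V →
      ∃ e : Fin 2 × Fin m → V, ∀ p q, B (e p) (e q) = symplecticForm m k p q := by
  induction m with
  | zero => exact fun _ _ _ => ⟨fun p => p.2.elim0, fun p => p.2.elim0⟩
  | succ m ih =>
    intro V _ _ _ B halt hB hV
    have : Nontrivial V := finrank_pos_iff.1 (show 0 < finrank k V by omega)
    obtain ⟨v, w, hvw⟩ := exists_apply_eq_one hB.1
    let U := B.orthogonal (Submodule.span k {v, w})
    have hU : finrank k V ≤ finrank k U + 2 :=
      finrank_le_finrank_orthogonal_span_pair_add_two hB v w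
    have finrank_U : 2 * m ≤ finrank k U := by omega
    obtain ⟨e, he⟩ := ih (B := B.restrict U) (fun x => halt x)
      (nondegenerate_restrict_orthogonal_span_pair halt hB hvw) finrank_U
    have apply_pair (a b : Fin 2) : B (![v, w] a) (![v, w] b) = !![0, 1; -1, 0] a b := by
      fin_cases a <;> fin_cases b <;> simp [halt.self_eq_zero, hvw, ← halt.neg_eq v w]
    have pair_ortho (a : Fin 2) (p) : B (![v, w] a) (e p) = 0 := by
      obtain ⟨hv, hw⟩ := mem_orthogonal_span_pair.1 (e p).2
      fin_cases a
      exacts [hv, hw]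
    have ortho_pair (a : Fin 2) (p) : B (e p) (![v, w] a) = 0 :=
      halt.isRefl _ _ (pair_ortho a p)
    have apply_e (p q) : B (e p) (e q) = symplecticForm m k p q := he p q
    refine ⟨fun p => Fin.cons (α := fun _ => V) (![v, w] p.1) (fun i => (e (p.1, i) : V)) p.2, ?_⟩
    rintro ⟨a, i⟩ ⟨b, j⟩
    cases i using Fin.cases <;> cases j using Fin.cases <;>
      simp [symplecticForm_apply, apply_pair, pair_ortho, ortho_pair, apply_e,
        (Fin.succ_ne_zero _).symm]

theorem exists_mul_mul_transpose_eq_symplecticForm {M : Matrix (Fin 2 × Fin m) (Fin 2 × Fin m) k}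
    (halt : ∀ v, v ⬝ᵥ M *ᵥ v = 0) (hM : M.det ≠ 0) :
    ∃ C : GL (Fin 2 × Fin m) k, C.1 * M * C.1ᵀ = symplecticForm m k := by
  have apply_eq (v w) : toBilin' M v w = v ⬝ᵥ M *ᵥ w := toBilin'_apply' M v w
  obtain ⟨e, he⟩ := exists_apply_eq_symplecticForm m (B := toBilin' M)
    (fun v => (apply_eq v v).trans (halt v))
    (LinearMap.BilinForm.nondegenerate_toBilin'_iff_det_ne_zero.2 hM) (by simp)
  let C : Matrix (Fin 2 × Fin m) (Fin 2 × Fin m) k := Matrix.of e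
  have mul_eq : C * M * Cᵀ = symplecticForm m k := by
    ext1 p q
    rw [← he, apply_eq, Matrix.mul_assoc]
    rfl
  have det_ne_zero : C.det ≠ 0 := fun h => by
    have := congrArg det mul_eq
    simp [h, det_symplecticForm] at this
  exact ⟨GeneralLinearGroup.mkOfDetNeZero C det_ne_zero, mul_eq⟩

theorem exists_map_eq_self_mul_mul_transpose_eq_symplecticForm (σ : k →+* k)
    {M : Matrix (Fin 2 × Fin m) (Fin 2 × Fin m) k} (hσ : M.map σ = M)
    (halt : ∀ v, v ⬝ᵥ M *ᵥ v = 0) (hM : M.det ≠ 0) :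
    ∃ C : GL (Fin 2 × Fin m) k,
      GeneralLinearGroup.map σ C = C ∧ C.1 * M * C.1ᵀ = symplecticForm m k := by
  let k₀ := σ.eqLocusField (RingHom.id k)
  let ι : k₀ →+* k := k₀.subtype
  obtain ⟨M₀, rfl⟩ : ∃ M₀ : Matrix (Fin 2 × Fin m) (Fin 2 × Fin m) k₀, ι.mapMatrix M₀ = M :=
    ⟨Matrix.of fun p q => ⟨M p q, congrFun₂ hσ p q⟩, rfl⟩
  have halt₀ (v : Fin 2 × Fin m → k₀) : v ⬝ᵥ M₀ *ᵥ v = 0 := by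
    have map_mulVec : ι ∘ (M₀ *ᵥ v) = ι.mapMatrix M₀ *ᵥ (ι ∘ v) :=
      funext (RingHom.map_mulVec ι M₀ v)
    rw [← map_eq_zero ι, RingHom.map_dotProduct, map_mulVec, halt]
  have det_ne_zero : M₀.det ≠ 0 := by rwa [← map_ne_zero ι, RingHom.map_det]
  obtain ⟨C, hC⟩ := exists_mul_mul_transpose_eq_symplecticForm halt₀ det_ne_zero
  refine ⟨GeneralLinearGroup.map ι C, Units.ext (Matrix.ext fun p q => (C p q).2), ?_⟩
  calc ι.mapMatrix C.1 * ι.mapMatrix M₀ * (ι.mapMatrix C.1)ᵀ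
      = ι.mapMatrix (C.1 * M₀ * C.1ᵀ) := by
        simp only [map_mul, RingHom.mapMatrix_apply, transpose_map]
    _ = symplecticForm m k := by rw [hC]; exact symplecticForm_map ι

theorem map_inv_mul_symplecticForm_mul {σ : k →+* k} {A Z : GL (Fin 2 × Fin m) k}
    (hA : A ∈ Sp m k) (hZ : A * GeneralLinearGroup.map σ Z = Z) :
    (Z⁻¹.1 * symplecticForm m k * Z⁻¹.1ᵀ).map σ = Z⁻¹.1 * symplecticForm m k * Z⁻¹.1ᵀ := by
  have map_Z_inv : Z⁻¹.1.map σ = Z⁻¹.1 * A.1 := by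
    have : GeneralLinearGroup.map σ Z⁻¹ = Z⁻¹ * A := by
      rw [map_inv, inv_eq_iff_eq_inv, _root_.mul_inv_rev, inv_inv, eq_inv_mul_iff_mul_eq, hZ]
    exact congrArg Units.val this
  have hA' : A.1 * symplecticForm m k * A.1ᵀ = symplecticForm m k := hA
  rw [Matrix.map_mul, Matrix.map_mul, symplecticForm_map, transpose_map, map_Z_inv, transpose_mul]
  calc Z⁻¹.1 * A.1 * symplecticForm m k * (A.1ᵀ * Z⁻¹.1ᵀ)
      = Z⁻¹.1 * (A.1 * symplecticForm m k * A.1ᵀ) * Z⁻¹.1ᵀ := by simp only [Matrix.mul_assoc]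
    _ = Z⁻¹.1 * symplecticForm m k * Z⁻¹.1ᵀ := by rw [hA']

theorem exists_mem_Sp_mul_map_eq {σ : k →+* k} {A Z : GL (Fin 2 × Fin m) k}
    (hA : A ∈ Sp m k) (hZ : A * GeneralLinearGroup.map σ Z = Z) :
    ∃ W ∈ Sp m k, A * GeneralLinearGroup.map σ W = W := by
  let Ω := symplecticForm m k
  let M := Z⁻¹.1 * Ω * Z⁻¹.1ᵀ
  have alternating (v) : v ⬝ᵥ M *ᵥ v = 0 := calc
    v ⬝ᵥ M *ᵥ v = v ⬝ᵥ Z⁻¹.1 *ᵥ Ω *ᵥ Z⁻¹.1ᵀ *ᵥ v := by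
      simp only [M, mulVec_mulVec, Matrix.mul_assoc]
    _ = (Z⁻¹.1ᵀ *ᵥ v) ⬝ᵥ Ω *ᵥ Z⁻¹.1ᵀ *ᵥ v := by rw [dotProduct_mulVec, mulVec_transpose]
    _ = 0 := dotProduct_symplecticForm_mulVec_self _
  have det_ne_zero : M.det ≠ 0 := by
    simp [M, Ω, det_symplecticForm, Z.det_ne_zero]
  obtain ⟨C, map_C, hC⟩ := exists_map_eq_self_mul_mul_transpose_eq_symplecticForm σ
    (map_inv_mul_symplecticForm_mul hA hZ) alternating det_ne_zero
  refine ⟨Z * C⁻¹, ?_, ?_⟩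
  · rw [← inv_mem_iff, _root_.mul_inv_rev, inv_inv]
    calc (C * Z⁻¹).1 * Ω * (C * Z⁻¹).1ᵀ = C.1 * M * C.1ᵀ := by
          simp only [M, Units.val_mul, transpose_mul, Matrix.mul_assoc]
      _ = Ω := hC
  · rw [map_mul, map_inv, map_C, ← mul_assoc, hZ]

end SymplecticForm

theorem theorem4_general {k F : Type*} [Field k] [Countable k] [Field F] [IsAlgClosed F]
    [Algebra k F] (hF : Cardinal.aleph0 ≤ Algebra.trdeg k F) (m : ℕ) :
    ∃ φ : F ≃+* F, reidemeisterNumber (Sp.inducedAut m φ) = 1 := by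
  obtain ⟨φ, lang⟩ := exists_ringEquiv_langSolvable_id (Fin 2 × Fin m) hF
  refine ⟨φ, reidemeisterNumber_eq_one fun A => ?_⟩
  obtain ⟨Z, hZ⟩ := lang A
  obtain ⟨W, hW, h⟩ := exists_mem_Sp_mul_map_eq A.2 hZ
  refine ⟨⟨W, hW⟩, ?_⟩
  rw [mul_one, eq_mul_inv_iff_mul_eq]
  exact Subtype.ext h

theorem theorem4 {F : Type*} [Field F] [IsAlgClosed F] [CharZero F]
    (hF : Cardinal.aleph0 ≤ Algebra.trdeg ℚ F) (m : ℕ) (hm : 1 ≤ m) :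
    ∃ φ : F ≃+* F, reidemeisterNumber (Sp.inducedAut m φ) = 1 := by
  exact theorem4_general hF m
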